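/- Let $n\ge 2$ and let $\kappa_1,\dots,\kappa_n\ge 2$ be integers; put $K=\sum_{i=1}^n\kappa_i$ and $m=K-2n+1$. Let $x_{i,j}$ ($1\le i\le n$, $1\le j\le\kappa_i$) be real numbers with $0<x_{i,1}<x_{i,2}<\cdots<x_{i,\kappa_i}$ for every $i$, and let $\beta_1>\beta_2>\cdots>\beta_n\ge 0$ be integers. For a real parameter $\tau>0$ let $M(\tau)$ be the $K\times K$ real matrix whose columns are indexed by the pairs $(i,j)$, $1\le i\le n$, $1\le j\le\kappa_i$, in lexicographic order, and whose rows, from top to bottom, are: (a) for $s=1,\dots,n$, the row whose entry in column $(i,j)$ is $1$ if $i=s$ and $0$ otherwise; (b) for $s=1,\dots,n$, the row whose entry in column $(i,j)$ is $x_{s,j}\tau^{\beta_s}$ if $i=s$ and $0$ otherwise; (c) for $\ell=2,3,\dots,m$, the row whose entry in column $(i,j)$ is $x_{i,j}^{\ell}\,\tau^{\ell\beta_i}$ (these are $K-2n$ rows; there are none if $K=2n$). Let $\Delta_{(\kappa_1,\dots,\kappa_n)}(\tau)=(-1)^{n(n-1)/2}\det M(\tau)$. Then there exists $\tau_0>0$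 such that $\Delta_{(\kappa_1,\dots,\kappa_n)}(\tau)>0$ for all $\tau\in(0,\tau_0)$. -/

import Mathlib

/-- The `K × K` block-structured matrix, `K = ∑ i, κ i`. Columns are grouped into `n` consecutive
blocks, the `i`-th one of size `κ i`; `finSigmaFinEquiv` is the lexicographic bijection between pairs
`(i, j)` (block, position in the block) and column numbers. With rows numbered from `0`:
* row `r < n` is the indicator of block `r`;
* row `n + s` with `s < n` has entries `x s j * τ ^ β s` on block `s` and `0` elsewhere;
* row `2 * n + s` has entries `(x i j) ^ (s + 2) * τ ^ ((s + 2) * β i)`, so that the exponents of these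
  `K - 2 * n` last rows run through `2, 3, …, K - 2 * n + 1`. -/
noncomputable def blockMatrix {n : ℕ} (κ : Fin n → ℕ) (x : (i : Fin n) → Fin (κ i) → ℝ)
    (β : Fin n → ℕ) (τ : ℝ) : Matrix (Fin (∑ i, κ i)) (Fin (∑ i, κ i)) ℝ :=
  Matrix.of fun r c =>
    let i : Fin n := (finSigmaFinEquiv.symm c).1
    let j : Fin (κ i) := (finSigmaFinEquiv.symm c).2
    if (r : ℕ) < n then
      if (r : ℕ) = i then 1 else 0
    else if (r : ℕ) < 2 * n then
      if (r : ℕ) = n + i then x i j * τ ^ β i else 0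
    else
      (x i j) ^ ((r : ℕ) - 2 * n + 2) * τ ^ (((r : ℕ) - 2 * n + 2) * β i)

/-- The signed determinant `Δ_{(κ₁, …, κₙ)}(τ)`, with sign factor `(-1) ^ (n (n - 1) / 2)`. -/
noncomputable def blockDelta {n : ℕ} (κ : Fin n → ℕ) (x : (i : Fin n) → Fin (κ i) → ℝ)
    (β : Fin n → ℕ) (τ : ℝ) : ℝ :=
  (-1) ^ (n * (n - 1) / 2) * (blockMatrix κ x β τ).det

/-! As `τ → 0` one assignment of rows to blocks dominates. Block `i` takes its indicator row, its
linear row and `κ i - 2` consecutive exponents; blocks with larger `β` take the smaller exponents.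
The sign of this assignment is exactly the prefactor of `blockDelta`
(`blockDelta_eq_det_submatrix`). Multiplying rows and columns by suitable powers of `τ` leaves
`scaledMatrix`, which is polynomial in `τ`. At `τ = 0` it is block triangular, and its diagonal
blocks are generalized Vandermonde matrices with positive determinant (`det_scaledMatrix_zero_pos`).
Continuity extends positivity to small `τ > 0`, where the scaling factors are positive. -/

/-! ### Generalized Vandermonde determinants via Descartes' rule of signs -/

open Polynomial in
theorem Polynomial.signVariations_lt_card_support {R : Type*} [Ring R] [LinearOrder R]
    {P : R[X]} (hP : P ≠ 0) : P.signVariations < P.support.card := by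
  generalize hd : P.support.card = d
  induction d generalizing P with
  | zero => simp_all
  | succ d ih =>
    by_cases hE : P.eraseLead = 0
    · rw [signVariations_eq_eraseLead_add_ite hP, hE]
      simp [hP]
    · have h1 := ih hE (P.card_support_eraseLead' hd)
      have h2 := P.signVariations_le_eraseLead_succ
      omega

open Polynomial in
/-- A nonzero polynomial with `k` monomials has fewer than `k` positive roots. -/
theorem Polynomial.card_lt_card_support_of_pos_roots {P : ℝ[X]} (hP : P ≠ 0) {S : Finset ℝ}
    (hS : ∀ t ∈ S, 0 < t ∧ P.eval t = 0) : S.card < P.support.card := by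
  refine lt_of_le_of_lt ?_ (signVariations_lt_card_support hP)
  refine le_trans ?_ P.roots_countP_pos_le_signVariations
  rw [Multiset.countP_eq_card_filter]
  refine Multiset.card_le_card (Finset.val_le_iff_val_subset.2 fun t ht => ?_)
  have := hS t ht
  simp [hP, this]

open Polynomial in
/-- The generalized Vandermonde determinant with increasing exponents and increasing positive nodes
is positive. -/
theorem Matrix.det_generalizedVandermonde_pos {k : ℕ} {f : Fin k → ℕ} (hf : StrictMono f)
    {x : Fin k → ℝ} (hx : StrictMono x) (hpos : ∀ j, 0 < x j) :
    0 < (Matrix.of fun i j => x j ^ f i).det := by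
  induction k with
  | zero => simp
  | succ k ih =>
    -- For a single node the polynomial below may be constant, so it need not tend to infinity.
    rcases Nat.eq_zero_or_pos k with rfl | hk
    · simpa using pow_pos (hpos 0) _
    -- Cofactors of the last column: `P` is the determinant with the last node made variable.
    let a : Fin (k + 1) → ℝ := fun i => (-1) ^ ((i : ℕ) + k) *
      (Matrix.of fun (p q : Fin k) => x q.castSucc ^ f (i.succAbove p)).det
    let P : ℝ[X] := ∑ i, monomial (f i) (a i)
    have heval : ∀ t : ℝ, P.eval t =
        (Matrix.of fun i j => (Fin.snoc (fun q : Fin k => x q.castSucc) t : Fin (k + 1) → ℝ) j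
          ^ f i).det := by
      intro t
      rw [Matrix.det_succ_column _ (Fin.last k)]
      simp only [P, a, eval_finsetSum, eval_monomial]
      refine Finset.sum_congr rfl fun i _ => ?_
      simp only [Fin.val_last, Matrix.of_apply, Fin.snoc_last]
      rw [mul_right_comm]
      congr 2
      ext p q
      simp
    have ha : 0 < a (Fin.last k) := by
      have := ih (f := fun p => f p.castSucc) (hf.comp (Fin.strictMono_castSucc))
        (x := fun p => x p.castSucc) (hx.comp (Fin.strictMono_castSucc)) (fun j => hpos _)
      simpa [a, ← two_mul] using this
    have hcoeff : P.coeff (f (Fin.last k)) = a (Fin.last k) := by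
      simp [P, coeff_monomial, hf.injective.eq_iff]
    have hP : P ≠ 0 := by
      intro h
      rw [h] at hcoeff
      simp at hcoeff
      linarith
    have hsupp : P.support.card ≤ k + 1 := by
      have : P.support ⊆ Finset.univ.image f := by
        intro m hm
        by_contra hm'
        simp only [Finset.mem_image, Finset.mem_univ, true_and, not_exists] at hm'
        exact mem_support_iff.1 hm (by simp [P, coeff_monomial, hm'])
      exact (Finset.card_le_card this).trans (Finset.card_image_le.trans (by simp))
    have hnat : P.natDegree = f (Fin.last k) := by
      refine le_antisymm ?_ (le_natDegree_of_ne_zero (by rw [hcoeff]; exact ha.ne'))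
      refine natDegree_sum_le_of_forall_le _ _ fun i _ => (natDegree_monomial_le _).trans ?_
      exact hf.monotone (Fin.le_last i)
    have hdeg : 0 < P.degree := by
      rw [← natDegree_pos_iff_degree_pos, hnat]
      exact lt_of_le_of_lt (Nat.zero_le _) (hf (show (0 : Fin (k + 1)) < Fin.last k from hk))
    have hlead : 0 ≤ P.leadingCoeff := by
      rw [leadingCoeff, hnat, hcoeff]; exact ha.le
    have hroot : ∀ q : Fin k, P.eval (x q.castSucc) = 0 := by
      intro q
      rw [heval]
      refine Matrix.det_zero_of_column_eq (i := q.castSucc) (j := Fin.last k) (Fin.castSucc_lt_last q).ne ?_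
      intro i
      simp
    have hsnoc : (Fin.snoc (fun q : Fin k => x q.castSucc) (x (Fin.last k)) : Fin (k + 1) → ℝ) = x :=
      Fin.snoc_init_self x
    have hlast := heval (x (Fin.last k))
    rw [hsnoc] at hlast
    rw [← hlast]
    -- A value `≤ 0` would force a root at or beyond the last node. With the `k` earlier nodes this
    -- makes `k + 1` positive roots, too many for `k + 1` monomials.
    by_contra! hle
    have htop := P.tendsto_atTop_of_leadingCoeff_nonneg hdeg hlead
    obtain ⟨T, hT0, hT⟩ :=
      ((htop.eventually_ge_atTop 0).and (Filter.eventually_ge_atTop (x (Fin.last k)))).exists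
    obtain ⟨t, ht, ht0⟩ := intermediate_value_Icc hT P.continuous.continuousOn ⟨hle, hT0⟩
    let S : Finset ℝ := insert t (Finset.univ.image fun q : Fin k => x q.castSucc)
    have hS : S.card = k + 1 := by
      rw [Finset.card_insert_of_notMem, Finset.card_image_of_injective]
      · simp
      · exact hx.injective.comp (Fin.castSucc_injective k)
      · simp only [Finset.mem_image, Finset.mem_univ, true_and, not_exists]
        intro q hq
        have := hx (Fin.castSucc_lt_last q)
        linarith [ht.1]
    have := card_lt_card_support_of_pos_roots hP (S := S) (by
      simp only [S, Finset.mem_insert, Finset.mem_image, Finset.mem_univ, true_and]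
      rintro s (rfl | ⟨q, rfl⟩)
      · exact ⟨(hpos _).trans_le ht.1, ht0⟩
      · exact ⟨hpos _, hroot q⟩)
    omega

/-! ### Lexicographic numbering of the columns -/

theorem Finset.sum_Iio_add_le_sum_Iio {n : ℕ} (f : Fin n → ℕ) {i k : Fin n} (h : i < k) :
    ∑ l ∈ Finset.Iio i, f l + f i ≤ ∑ l ∈ Finset.Iio k, f l := by
  rw [add_comm, ← Finset.sum_insert (by simp)]
  refine Finset.sum_le_sum_of_subset fun l hl => ?_
  simp only [Finset.mem_insert, Finset.mem_Iio] at hl ⊢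
  rcases hl with rfl | hl
  · exact h
  · exact hl.trans h

theorem Finset.sum_Iio_add_le_sum_univ {n : ℕ} (f : Fin n → ℕ) (i : Fin n) :
    ∑ l ∈ Finset.Iio i, f l + f i ≤ ∑ l, f l := by
  rw [add_comm, ← Finset.sum_insert (by simp)]
  exact Finset.sum_le_sum_of_subset (Finset.subset_univ _)

theorem finSigmaFinEquiv_apply_eq_sum_Iio {n : ℕ} {κ : Fin n → ℕ} (p : (i : Fin n) × Fin (κ i)) :
    (finSigmaFinEquiv p : ℕ) = ∑ l ∈ Finset.Iio p.1, κ l + p.2 := by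
  rw [finSigmaFinEquiv_apply]
  congr 1
  refine Finset.sum_bij (fun l _ => Fin.castLE p.1.2.le l) ?_ ?_ ?_ ?_
  · intro l _
    simp [Fin.lt_def]
  · intro a _ b _ h
    simpa using h
  · intro b hb
    exact ⟨⟨b, Fin.lt_def.1 (Finset.mem_Iio.1 hb)⟩, Finset.mem_univ _, rfl⟩
  · intros; rfl

theorem finSigmaFinEquiv_lt_of_fst_lt {n : ℕ} {κ : Fin n → ℕ} {p q : (i : Fin n) × Fin (κ i)}
    (h : p.1 < q.1) : finSigmaFinEquiv p < finSigmaFinEquiv q := by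
  rw [Fin.lt_def, finSigmaFinEquiv_apply_eq_sum_Iio, finSigmaFinEquiv_apply_eq_sum_Iio]
  have := Finset.sum_Iio_add_le_sum_Iio κ h
  have := p.2.2
  omega

/-! ### The dominant matching of columns with rows -/

/-- The number of exponents `≥ 2` that are matched with the blocks before block `i`. -/
def powerOffset {n : ℕ} (κ : Fin n → ℕ) (i : Fin n) : ℕ := ∑ l ∈ Finset.Iio i, (κ l - 2)

theorem powerOffset_add_le {n : ℕ} (κ : Fin n → ℕ) {i k : Fin n} (h : i < k) :
    powerOffset κ i + (κ i - 2) ≤ powerOffset κ k :=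
  Finset.sum_Iio_add_le_sum_Iio (fun l => κ l - 2) h

theorem sum_eq_two_mul_add_sum_sub_two {n : ℕ} {κ : Fin n → ℕ} (hκ : ∀ i, 2 ≤ κ i) :
    ∑ i, κ i = 2 * n + ∑ i, (κ i - 2) := by
  have : ∀ i, κ i = 2 + (κ i - 2) := fun i => by have := hκ i; omega
  conv_lhs => rw [Finset.sum_congr rfl fun i _ => this i]
  rw [Finset.sum_add_distrib]
  simp [mul_comm]

/-- The row of `blockMatrix` that is matched with the column `(i, j)` in the dominant term of the
determinant. -/
def matchedRow {n : ℕ} (κ : Fin n → ℕ) (p : (i : Fin n) × Fin (κ i)) : ℕ :=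
  if (p.2 : ℕ) = 0 then p.1
  else if (p.2 : ℕ) = 1 then n + p.1
  else 2 * n + powerOffset κ p.1 + (p.2 - 2)

theorem matchedRow_lt {n : ℕ} {κ : Fin n → ℕ} (hκ : ∀ i, 2 ≤ κ i) (p : (i : Fin n) × Fin (κ i)) :
    matchedRow κ p < ∑ i, κ i := by
  rw [sum_eq_two_mul_add_sum_sub_two hκ]
  have h : powerOffset κ p.1 + (κ p.1 - 2) ≤ ∑ i, (κ i - 2) :=
    Finset.sum_Iio_add_le_sum_univ (fun l => κ l - 2) p.1
  have := p.1.2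
  have := p.2.2
  unfold matchedRow
  split_ifs <;> omega

theorem matchedRow_lt_matchedRow {n : ℕ} {κ : Fin n → ℕ} {i k : Fin n} (h : i < k)
    (j : Fin (κ i)) (l : Fin (κ k)) :
    matchedRow κ ⟨i, j⟩ < matchedRow κ ⟨k, l⟩ ↔
      (j : ℕ) = 0 ∨ ((j : ℕ) = 1 ∧ (l : ℕ) ≠ 0) ∨ (2 ≤ (j : ℕ) ∧ 2 ≤ (l : ℕ)) := by
  have := powerOffset_add_le κ h
  have := i.2
  have := k.2
  have := j.2
  have : (i : ℕ) < k := h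
  simp only [matchedRow]
  split_ifs <;> omega

theorem matchedRow_lt_matchedRow_of_lt {n : ℕ} {κ : Fin n → ℕ} (i : Fin n) {j l : Fin (κ i)}
    (h : j < l) : matchedRow κ ⟨i, j⟩ < matchedRow κ ⟨i, l⟩ := by
  have := i.2
  have : (j : ℕ) < l := h
  simp only [matchedRow]
  split_ifs <;> omega

theorem matchedRow_injective {n : ℕ} (κ : Fin n → ℕ) : Function.Injective (matchedRow κ) := by
  rintro ⟨i, j⟩ ⟨k, l⟩ h
  wlog hik : i ≤ k generalizing i k
  · exact (this k l i j h.symm (le_of_not_ge hik)).symm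
  rcases hik.eq_or_lt with rfl | hik
  · rcases lt_trichotomy j l with hjl | rfl | hjl
    · exact absurd h (matchedRow_lt_matchedRow_of_lt i hjl).ne
    · rfl
    · exact absurd h (matchedRow_lt_matchedRow_of_lt i hjl).ne'
  · exfalso
    have := powerOffset_add_le κ hik
    have := i.2
    have := k.2
    have := j.2
    have : (i : ℕ) < k := hik
    simp only [matchedRow] at h
    split_ifs at h <;> omega

/-- `matchedRow` as an equivalence between columns and rows. -/
noncomputable def matchedRowEquiv {n : ℕ} {κ : Fin n → ℕ} (hκ : ∀ i, 2 ≤ κ i) :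
    ((i : Fin n) × Fin (κ i)) ≃ Fin (∑ i, κ i) :=
  Equiv.ofBijective (fun p => ⟨matchedRow κ p, matchedRow_lt hκ p⟩) <| by
    rw [Fintype.bijective_iff_injective_and_card]
    refine ⟨fun p q h => matchedRow_injective κ (Fin.ext_iff.1 h), by simp⟩

@[simp]
theorem coe_matchedRowEquiv {n : ℕ} {κ : Fin n → ℕ} (hκ : ∀ i, 2 ≤ κ i)
    (p : (i : Fin n) × Fin (κ i)) : (matchedRowEquiv hκ p : ℕ) = matchedRow κ p := rfl

/-! ### Sign of the matching -/

/-- The inversions are `(j, l) = (1, 0)` and all `j ≥ 2` with `l ∈ {0, 1}`: `1 + 2 * (κ i - 2)` of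
them, an odd number. -/
theorem prod_sign_matchedRow {n : ℕ} {κ : Fin n → ℕ} (hκ : ∀ i, 2 ≤ κ i) {i k : Fin n}
    (h : i < k) :
    ∏ j : Fin (κ i), ∏ l : Fin (κ k),
      (if matchedRow κ ⟨i, j⟩ < matchedRow κ ⟨k, l⟩ then 1 else -1 : ℤˣ) = -1 := by
  have hk := hκ k
  have hi := hκ i
  have key : ∀ (j : Fin (κ i)) (l : Fin (κ k)),
      (if matchedRow κ ⟨i, j⟩ < matchedRow κ ⟨k, l⟩ then 1 else -1 : ℤˣ) =
      (if l = ⟨0, by omega⟩ then (if (j : ℕ) = 0 then 1 else -1) else 1) *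
      (if l = ⟨1, by omega⟩ then (if (j : ℕ) < 2 then 1 else -1) else 1) := by
    intro j l
    simp only [matchedRow_lt_matchedRow h, Fin.ext_iff]
    split_ifs <;> first | rfl | omega
  simp only [key, Finset.prod_mul_distrib, Finset.prod_ite_eq', Finset.mem_univ, if_true]
  rw [← Finset.prod_mul_distrib]
  have key' : ∀ j : Fin (κ i), ((if (j : ℕ) = 0 then 1 else -1) * (if (j : ℕ) < 2 then 1 else -1) : ℤˣ)
      = if j = ⟨1, by omega⟩ then -1 else 1 := by
    intro j
    simp only [Fin.ext_iff]
    split_ifs <;> first | rfl | omega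
  rw [Finset.prod_congr rfl fun j _ => key' j, Finset.prod_ite_eq', if_pos (Finset.mem_univ _)]

/-- There are no inversions inside a block, and each of the `n (n - 1) / 2` pairs of blocks
contributes `-1`. -/
theorem sign_finSigmaFinEquiv_symm_trans_matchedRowEquiv {n : ℕ} {κ : Fin n → ℕ}
    (hκ : ∀ i, 2 ≤ κ i) :
    Equiv.Perm.sign (finSigmaFinEquiv.symm.trans (matchedRowEquiv hκ)) =
      (-1) ^ (n * (n - 1) / 2) := by
  have hblock : ∀ i k : Fin n, (∏ j : Fin (κ i), ∏ l : Fin (κ k),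
      (if finSigmaFinEquiv (⟨i, j⟩ : (i : Fin n) × Fin (κ i)) < finSigmaFinEquiv ⟨k, l⟩ then
        (if matchedRow κ ⟨i, j⟩ < matchedRow κ ⟨k, l⟩ then 1 else -1) else 1 : ℤˣ)) =
      if i < k then -1 else 1 := by
    intro i k
    rcases lt_trichotomy i k with h | rfl | h
    · rw [if_pos h]
      refine Eq.trans ?_ (prod_sign_matchedRow hκ h)
      refine Finset.prod_congr rfl fun j _ => Finset.prod_congr rfl fun l _ => ?_
      rw [if_pos (finSigmaFinEquiv_lt_of_fst_lt h)]
    · rw [if_neg (lt_irrefl _)]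
      refine Finset.prod_eq_one fun j _ => Finset.prod_eq_one fun l _ => ?_
      split_ifs with h1 h2
      · rfl
      · rw [Fin.lt_def, finSigmaFinEquiv_apply_eq_sum_Iio, finSigmaFinEquiv_apply_eq_sum_Iio] at h1
        exact absurd (matchedRow_lt_matchedRow_of_lt i (Fin.lt_def.2 (by simpa using h1))) h2
      · rfl
    · rw [if_neg h.not_gt]
      refine Finset.prod_eq_one fun j _ => Finset.prod_eq_one fun l _ => ?_
      rw [if_neg (finSigmaFinEquiv_lt_of_fst_lt h).not_gt]
  rw [Equiv.Perm.sign_eq_prod_prod_Ioi]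
  have h1 : ∀ a : Fin (∑ i, κ i), Finset.Ioi a = Finset.univ.filter (fun b => a < b) := by
    intro a; ext; simp
  simp only [h1, Finset.prod_filter]
  rw [← finSigmaFinEquiv.prod_comp]
  have h2 : ∀ p : (i : Fin n) × Fin (κ i), ∀ g : Fin (∑ i, κ i) → ℤˣ,
      ∏ b, g b = ∏ q : (i : Fin n) × Fin (κ i), g (finSigmaFinEquiv q) :=
    fun p g => (finSigmaFinEquiv.prod_comp g).symm
  rw [Finset.prod_congr rfl fun p _ => h2 p _]
  simp only [Equiv.trans_apply, Equiv.symm_apply_apply, Fin.lt_def, coe_matchedRowEquiv]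
  simp only [← Fin.lt_def]
  rw [Fintype.prod_sigma]
  simp only [Fintype.prod_sigma]
  have h3 : ∀ i : Fin n, ∀ g : Fin (κ i) → Fin n → ℤˣ,
      ∏ j, ∏ k, g j k = ∏ k, ∏ j, g j k := fun i g => Finset.prod_comm
  rw [Finset.prod_congr rfl fun i _ => h3 i _]
  simp only [hblock]
  have h4 : ∀ i : Fin n, (∏ k, if i < k then -1 else 1 : ℤˣ) = (-1) ^ (n - 1 - (i : ℕ)) := by
    intro i
    rw [← Finset.prod_filter, Finset.prod_const]
    congr 1
    have : Finset.univ.filter (fun k => i < k) = Finset.Ioi i := by ext; simp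
    rw [this, Fin.card_Ioi]
  simp only [h4]
  rw [Finset.prod_pow_eq_pow_sum, Fin.sum_univ_eq_sum_range (fun i => n - 1 - i),
    Finset.sum_range_reflect (fun i => i), Finset.sum_range_id]

theorem blockDelta_eq_det_submatrix {n : ℕ} {κ : Fin n → ℕ} (hκ : ∀ i, 2 ≤ κ i)
    (x : (i : Fin n) → Fin (κ i) → ℝ) (β : Fin n → ℕ) (τ : ℝ) :
    blockDelta κ x β τ =
      ((blockMatrix κ x β τ).submatrix (matchedRowEquiv hκ) finSigmaFinEquiv).det := by
  have h : (blockMatrix κ x β τ).submatrix (matchedRowEquiv hκ) finSigmaFinEquiv =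
      ((blockMatrix κ x β τ).submatrix (finSigmaFinEquiv.symm.trans (matchedRowEquiv hκ)) id).submatrix
        finSigmaFinEquiv finSigmaFinEquiv := by
    ext p q
    simp
  rw [h, Matrix.det_submatrix_equiv_self, Matrix.det_permute,
    sign_finSigmaFinEquiv_symm_trans_matchedRowEquiv, blockDelta]
  simp

/-! ### Column weights and minimality of the matched block -/

/-- The exponent of `τ` by which the columns of block `i` are scaled. -/
def columnWeight {n : ℕ} (κ β : Fin n → ℕ) (i : Fin n) : ℕ :=
  ∑ l, (β l - β i) * (κ l - 2) + 2 * (∑ l, β l - β i)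

theorem powerOffset_eq_sum_ite {n : ℕ} (κ : Fin n → ℕ) (i : Fin n) :
    powerOffset κ i = ∑ l, (if l < i then 1 else 0) * (κ l - 2) := by
  simp only [ite_mul, one_mul, zero_mul]
  rw [← Finset.sum_filter, powerOffset]
  congr 1
  ext; simp

/-- From block `i` to the next, `columnWeight` grows by exactly `β i - β (i + 1)` times `powerOffset
κ (i + 1) + 2`. Offsets increase, so summing these jumps explains both this bound and
`le_columnWeight`. Truncated subtraction removes the terms `l ≥ i` from the first sum defining the
weight of block `i`. -/
theorem columnWeight_le {n : ℕ} (κ : Fin n → ℕ) {β : Fin n → ℕ} (hβ : Antitone β) {i k : Fin n}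
    (h : i < k) :
    columnWeight κ β k ≤ columnWeight κ β i + (β i - β k) * (powerOffset κ k + 2) := by
  have h1 : ∑ l, (β l - β k) * (κ l - 2) ≤
      ∑ l, (β l - β i) * (κ l - 2) + (β i - β k) * powerOffset κ k := by
    rw [powerOffset_eq_sum_ite, Finset.mul_sum, ← Finset.sum_add_distrib]
    refine Finset.sum_le_sum fun l _ => ?_
    rw [← mul_assoc, ← add_mul]
    refine Nat.mul_le_mul_right _ ?_
    split_ifs with hl
    · omega
    · have := hβ (not_lt.1 hl)
      omega
  have := hβ h.le
  have := Finset.single_le_sum (f := β) (fun _ _ => Nat.zero_le _) (Finset.mem_univ i)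
  simp only [columnWeight, mul_add]
  omega

theorem le_columnWeight {n : ℕ} (κ : Fin n → ℕ) {β : Fin n → ℕ} (hβ : Antitone β) {i k : Fin n}
    (h : i < k) :
    columnWeight κ β i + (β i - β k) * (powerOffset κ i + (κ i - 2) + 2) ≤ columnWeight κ β k := by
  have h1 : ∑ l, (β l - β i) * (κ l - 2) + (β i - β k) * (powerOffset κ i + (κ i - 2)) ≤
      ∑ l, (β l - β k) * (κ l - 2) := by
    have h2 : powerOffset κ i + (κ i - 2) = ∑ l, (if l ≤ i then 1 else 0) * (κ l - 2) := by
      have h3 : κ i - 2 = ∑ l, (if l = i then 1 else 0) * (κ l - 2) := by simp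
      rw [h3, powerOffset_eq_sum_ite, ← Finset.sum_add_distrib]
      refine Finset.sum_congr rfl fun l _ => ?_
      rw [← add_mul]
      congr 1
      split_ifs <;> first | rfl | order
    rw [h2, Finset.mul_sum, ← Finset.sum_add_distrib]
    refine Finset.sum_le_sum fun l _ => ?_
    rw [← mul_assoc, ← add_mul]
    refine Nat.mul_le_mul_right _ ?_
    have := hβ h.le
    split_ifs with hl
    · have := hβ hl
      omega
    · omega
  have := hβ h.le
  have := Finset.single_le_sum (f := β) (fun _ _ => Nat.zero_le _) (Finset.mem_univ i)
  simp only [columnWeight, mul_add] at h1 ⊢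
  omega

/-- For an exponent `e` matched with block `i`, `e * β k + columnWeight κ β k` is least at `k = i`.
It is strictly larger for later blocks, but ties with earlier ones can occur; hence triangular
rather than diagonal blocks. -/
theorem matched_weight_lt {n : ℕ} {κ β : Fin n → ℕ} (hβ : StrictAnti β) {i k : Fin n}
    (h : i < k) {j : ℕ} (hj : 2 ≤ j) (hj' : j < κ i) :
    (powerOffset κ i + j) * β i + columnWeight κ β i <
      (powerOffset κ i + j) * β k + columnWeight κ β k := by
  have h1 := le_columnWeight κ hβ.antitone h
  obtain ⟨d, hd⟩ := Nat.exists_eq_add_of_lt (hβ h)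
  have h2 : β i - β k = d + 1 := by omega
  rw [h2] at h1
  rw [hd]
  -- Strictness comes from `j < κ i`: the exponent is at least one below the slope in `h1`.
  have h3 : powerOffset κ i + j + 1 ≤ powerOffset κ i + (κ i - 2) + 2 := by omega
  have h4 := Nat.mul_le_mul_left (d + 1) h3
  nlinarith

theorem matched_weight_le {n : ℕ} {κ β : Fin n → ℕ} (hβ : StrictAnti β) {i k : Fin n}
    (h : k ≤ i) {j : ℕ} (hj : 2 ≤ j) :
    (powerOffset κ i + j) * β i + columnWeight κ β i ≤
      (powerOffset κ i + j) * β k + columnWeight κ β k := by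
  rcases h.eq_or_lt with rfl | h
  · exact le_rfl
  have h1 := columnWeight_le κ hβ.antitone h
  obtain ⟨d, hd⟩ := Nat.exists_eq_add_of_lt (hβ h)
  have h2 : β k - β i = d + 1 := by omega
  rw [h2] at h1
  rw [hd]
  have h3 : powerOffset κ i + 2 ≤ powerOffset κ i + j := by omega
  have h4 := Nat.mul_le_mul_left (d + 1) h3
  nlinarith

/-! ### The rescaled matrix and its value at `τ = 0` -/

/-- The matrix obtained from `blockMatrix` by permuting the rows and dividing rows and columns by
powers of `τ`. -/
noncomputable def scaledMatrix {n : ℕ} (κ : Fin n → ℕ) (x : (i : Fin n) → Fin (κ i) → ℝ)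
    (β : Fin n → ℕ) (τ : ℝ) : Matrix ((i : Fin n) × Fin (κ i)) ((i : Fin n) × Fin (κ i)) ℝ :=
  Matrix.of fun p q =>
    if (p.2 : ℕ) < 2 then if p.1 = q.1 then x q.1 q.2 ^ (p.2 : ℕ) else 0
    else x q.1 q.2 ^ (powerOffset κ p.1 + p.2) *
      τ ^ (((powerOffset κ p.1 + p.2) * β q.1 + columnWeight κ β q.1) -
        ((powerOffset κ p.1 + p.2) * β p.1 + columnWeight κ β p.1))

theorem submatrix_mul_pow_columnWeight {n : ℕ} {κ : Fin n → ℕ} (hκ : ∀ i, 2 ≤ κ i)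
    (x : (i : Fin n) → Fin (κ i) → ℝ) {β : Fin n → ℕ} (hβ : StrictAnti β) (τ : ℝ)
    (p q : (i : Fin n) × Fin (κ i)) :
    τ ^ columnWeight κ β q.1 *
        (blockMatrix κ x β τ).submatrix (matchedRowEquiv hκ) finSigmaFinEquiv p q =
      τ ^ ((if (p.2 : ℕ) < 2 then (p.2 : ℕ) * β p.1 else (powerOffset κ p.1 + p.2) * β p.1) +
        columnWeight κ β p.1) * scaledMatrix κ x β τ p q := by
  obtain ⟨i, j⟩ := p
  obtain ⟨k, l⟩ := q
  have hi := i.2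
  have hx : x (finSigmaFinEquiv.symm (finSigmaFinEquiv ⟨k, l⟩)).1
      (finSigmaFinEquiv.symm (finSigmaFinEquiv ⟨k, l⟩)).2 = x k l :=
    congrArg (fun q : (i : Fin n) × Fin (κ i) => x q.1 q.2) (Equiv.symm_apply_apply _ _)
  simp only [blockMatrix, scaledMatrix, Matrix.submatrix_apply, Matrix.of_apply, hx,
    coe_matchedRowEquiv, Equiv.symm_apply_apply, matchedRow]
  by_cases h0 : (j : ℕ) = 0
  · by_cases hik : i = k
    · subst hik; simp [h0]
    · have : (i : ℕ) ≠ k := fun h => hik (Fin.ext h)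
      simp [h0, hik, this]
  by_cases h1 : (j : ℕ) = 1
  · have h2 : ¬ n + (i : ℕ) < n := by omega
    have h3 : n + (i : ℕ) < 2 * n := by omega
    by_cases hik : i = k
    · subst hik
      simp [h1, h3]
      ring
    · have : (i : ℕ) ≠ k := fun h => hik (Fin.ext h)
      simp [h1, h3, hik, this]
  · have h2 : ¬ (j : ℕ) < 2 := by omega
    have h3 : ¬ 2 * n + powerOffset κ i + (j - 2) < n := by omega
    have h4 : ¬ 2 * n + powerOffset κ i + (j - 2) < 2 * n := by omega
    have h5 : 2 * n + powerOffset κ i + (j - 2) - 2 * n + 2 = powerOffset κ i + j := by omega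
    -- Minimality makes the truncated subtraction in `scaledMatrix` exact.
    have h6 : (powerOffset κ i + j) * β i + columnWeight κ β i ≤
        (powerOffset κ i + j) * β k + columnWeight κ β k := by
      rcases lt_or_ge i k with h | h
      · exact (matched_weight_lt hβ h (not_lt.1 h2) j.2).le
      · exact matched_weight_le hβ h (not_lt.1 h2)
    simp only [if_neg h0, if_neg h1, if_neg h2, if_neg h3, if_neg h4, h5]
    rw [mul_left_comm, ← pow_add, mul_left_comm, ← pow_add, Nat.add_sub_cancel' h6,
      add_comm (columnWeight κ β k)]

theorem continuous_det_scaledMatrix {n : ℕ} (κ : Fin n → ℕ) (x : (i : Fin n) → Fin (κ i) → ℝ)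
    (β : Fin n → ℕ) : Continuous fun τ => (scaledMatrix κ x β τ).det := by
  refine Continuous.matrix_det (continuous_matrix fun p q => ?_)
  simp only [scaledMatrix, Matrix.of_apply]
  split_ifs <;> fun_prop

theorem det_scaledMatrix_zero_pos {n : ℕ} {κ : Fin n → ℕ} {x : (i : Fin n) → Fin (κ i) → ℝ}
    (hx_pos : ∀ i j, 0 < x i j) (hx_mono : ∀ i, StrictMono (x i))
    {β : Fin n → ℕ} (hβ : StrictAnti β) : 0 < (scaledMatrix κ x β 0).det := by
  have htri : (scaledMatrix κ x β 0).transpose.BlockTriangular Sigma.fst := by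
    rintro ⟨k, l⟩ ⟨i, j⟩ (h : i < k)
    simp only [scaledMatrix, Matrix.transpose_apply, Matrix.of_apply, if_neg h.ne]
    split_ifs with hj
    · rfl
    · have := matched_weight_lt hβ h (not_lt.1 hj) j.2
      rw [zero_pow (by omega), mul_zero]
  rw [← Matrix.det_transpose, htri.det_fintype]
  refine Finset.prod_pos fun i _ => ?_
  have hf : StrictMono fun j : Fin (κ i) =>
      if (j : ℕ) < 2 then (j : ℕ) else powerOffset κ i + j := by
    intro j l h
    have : (j : ℕ) < l := h
    simp only
    split_ifs <;> omega
  refine (Matrix.det_generalizedVandermonde_pos hf (hx_mono i) (hx_pos i)).trans_eq ?_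
  let e : Fin (κ i) ≃ {p : (i : Fin n) × Fin (κ i) // p.1 = i} := (Equiv.sigmaSubtype (β := fun i => Fin (κ i)) i).symm
  rw [← Matrix.det_transpose, ← Matrix.det_submatrix_equiv_self e]
  congr 1
  ext l j
  -- On a diagonal block the exponent of `τ` is zero, and `0 ^ 0 = 1` keeps the entry.
  change x i l ^ (if (j : ℕ) < 2 then (j : ℕ) else powerOffset κ i + j) =
    (if (j : ℕ) < 2 then if i = i then x i l ^ (j : ℕ) else 0
      else x i l ^ (powerOffset κ i + j) *
        0 ^ (((powerOffset κ i + j) * β i + columnWeight κ β i) -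
          ((powerOffset κ i + j) * β i + columnWeight κ β i)))
  rw [if_pos rfl]
  split_ifs <;> simp

/-! ### Passage to small positive `τ` -/

theorem lemma2 (n : ℕ) (hn : 2 ≤ n) (κ : Fin n → ℕ) (hκ : ∀ i, 2 ≤ κ i)
    (x : (i : Fin n) → Fin (κ i) → ℝ) (hx_pos : ∀ i j, 0 < x i j)
    (hx_mono : ∀ i, StrictMono (x i))
    (β : Fin n → ℕ) (hβ : StrictAnti β) :
    ∃ τ₀ : ℝ, 0 < τ₀ ∧ ∀ τ ∈ Set.Ioo 0 τ₀, 0 < blockDelta κ x β τ := by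
  have hev : ∀ᶠ τ in nhds (0 : ℝ), 0 < (scaledMatrix κ x β τ).det :=
    (continuous_det_scaledMatrix κ x β).continuousAt.eventually
      (lt_mem_nhds (det_scaledMatrix_zero_pos hx_pos hx_mono hβ))
  obtain ⟨τ₀, hτ₀, h⟩ := Metric.eventually_nhds_iff.1 hev
  refine ⟨τ₀, hτ₀, fun τ hτ => ?_⟩
  have hdet : 0 < (scaledMatrix κ x β τ).det := h (by
    rw [Real.dist_eq, sub_zero, abs_of_pos hτ.1]
    exact hτ.2)
  rw [blockDelta_eq_det_submatrix hκ]
  have hscale : (Matrix.of fun p q => τ ^ columnWeight κ β q.1 *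
      (blockMatrix κ x β τ).submatrix (matchedRowEquiv hκ) finSigmaFinEquiv p q).det = _ :=
    congrArg Matrix.det (Matrix.ext (submatrix_mul_pow_columnWeight hκ x hβ τ) :
      _ = Matrix.of fun p q => τ ^ (_ : ℕ) * scaledMatrix κ x β τ p q)
  rw [Matrix.det_mul_row (fun q : (i : Fin n) × Fin (κ i) => τ ^ columnWeight κ β q.1), Matrix.det_mul_column] at hscale
  have hpos : ∀ f : ((i : Fin n) × Fin (κ i)) → ℕ, 0 < ∏ p, τ ^ f p :=
    fun f => Finset.prod_pos fun p _ => pow_pos hτ.1 _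
  refine pos_of_mul_pos_right (a := ∏ q : (i : Fin n) × Fin (κ i), τ ^ columnWeight κ β q.1) ?_
    (hpos _).le
  rw [hscale]
  exact mul_pos (hpos _) hdet
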